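/- Let $K$ be a field of characteristic $0$ and $N\ge 0$. For integers $0\le n_1,\dots,n_N<N$ the confluent Vandermonde form (cv-form) $[n_1\cdots n_N]\in K[t_1,\dots,t_N]$ is the determinant of the $N\times N$ matrix whose $(i,j)$ entry is $t_j^{\,n_j-i+1}/(n_j-i+1)!$ if $n_j-i+1\ge 0$, and $0$ otherwise. A polynomial $f$ is called $S_N$-harmonic if $\sum_{i=1}^N \partial^k f/\partial t_i^k=0$ for all $k\ge 1$. For every sequence $k_1\ge k_2\ge\cdots\ge k_N=0$ of integers with $k_i-k_{i+1}\le 1$, take the ribbon diagram with $N$ boxes at the matrix coordinates (row, column) $(k_i,\,k_i+i-1)$, $i=1,\dots,N$ (rows are numbered downwards, columns from left to right), and all its standard fillings, i.e. the bijective fillings with $1,\dots,N$ that increase from left to right in rows and from top to bottom in columns. Let $\mathcal T_N$ be the set of all standard ribbon tableaux so obtained. For a permutation $\sigma\in S_N$ (a reading order) and $T\in\mathcal T_N$, let $F_\sigma(T)=[n_1\cdots n_N]$, where $n_i$ is the column coordinate of the box of $T$ that contains $\sigma(i)$; the backward reading is $\sigma(k)=N-k+1$. Theorem. The set $\mathcal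 T_N$ has $N!$ elements, and the span of all cv-forms in $N$ variables is the space of $S_N$-harmonic polynomials. For each $\sigma\in S_N$ the family $(F_\sigma(T))_{T\in\mathcal T_N}$ is linearly independent and spans this space, so it is a basis with $N!$ elements; moreover, $F_\sigma(T)$ is homogeneous of degree $k_1+\cdots+k_N$, where $(k_1,\dots,k_N)$ is the sequence that gives the shape of $T$. The $N!$ bases $\{F_\sigma(T):T\in\mathcal T_N\}$, $\sigma\in S_N$, are pairwise distinct as sets of polynomials. -/

import Mathlib

namespace ConfluentVandermonde

/-- The confluent Vandermonde form `[n_1 ⋯ n_N]`: the determinant whose `(i, j)` entry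
(rows `i` and columns `j` counted from `0`) is `t_j ^ (n_j - i) / (n_j - i)!` if `i ≤ n_j`,
and `0` otherwise. -/
noncomputable def cvForm (K : Type*) [Field K] {N : ℕ} (n : Fin N → ℕ) :
    MvPolynomial (Fin N) K :=
  Matrix.det (Matrix.of fun i j : Fin N =>
    if (i : ℕ) ≤ n j then
      MvPolynomial.C ((((n j - (i : ℕ)).factorial : ℕ) : K)⁻¹) *
        MvPolynomial.X j ^ (n j - (i : ℕ))
    else 0)

/-- The linear span of all confluent Vandermonde forms in `N` variables,
with entries `0 ≤ n_i < N`. -/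
noncomputable def cvSpan (K : Type*) [Field K] (N : ℕ) :
    Submodule K (MvPolynomial (Fin N) K) :=
  Submodule.span K (Set.range fun n : Fin N → Fin N => cvForm K fun i => (n i : ℕ))

/-- The symmetrized derivative `∑ i, ∂ ^ k / ∂ t_i ^ k`. -/
noncomputable def symmDeriv (K : Type*) [Field K] (N k : ℕ) :
    Module.End K (MvPolynomial (Fin N) K) :=
  ∑ i : Fin N, ((MvPolynomial.pderiv i :
    Derivation K (MvPolynomial (Fin N) K) (MvPolynomial (Fin N) K)) :
      Module.End K (MvPolynomial (Fin N) K)) ^ k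

/-- The `S_N`-harmonic polynomials: those annihilated by all symmetrized derivatives
of positive order. -/
noncomputable def harmonics (K : Type*) [Field K] (N : ℕ) :
    Submodule K (MvPolynomial (Fin N) K) :=
  ⨅ k : ℕ, LinearMap.ker (symmDeriv K N (k + 1))

/-- The partitions `k_1 ≥ k_2 ≥ ⋯ ≥ k_N = 0` with `k_i - k_{i+1} ≤ 1`. -/
@[ext]
structure RibbonClass (N : ℕ) where
  part : Fin N → ℕ
  antitone : Antitone part
  step : ∀ i j : Fin N, (i : ℕ) + 1 = (j : ℕ) → part i ≤ part j + 1
  last : ∀ i : Fin N, (i : ℕ) + 1 = N → part i = 0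

/-- The number `d` that is partitioned, which is the degree of the associated forms. -/
def RibbonClass.size {N : ℕ} (c : RibbonClass N) : ℕ :=
  ∑ i, c.part i

/-- The ribbon diagram of a class: `N` boxes at the matrix coordinates (row, column)
`(k_i, k_i + i - 1)`, `i = 1, …, N`. Rows are numbered downwards from `0` and columns rightwards,
the rightmost column of the diagram being column `N - 1`.
(Here `i : Fin N` is counted from `0`.) -/
def RibbonClass.diagram {N : ℕ} (c : RibbonClass N) : Finset (ℕ × ℕ) :=
  Finset.univ.image fun i : Fin N => (c.part i, c.part i + (i : ℕ))

/-- A standard filling of a diagram with `N` boxes: every number occurs exactly once, and the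
entries increase from left to right in rows and from top to bottom in columns.
The entry `k ∈ {1, …, N}` is represented by `k - 1 : Fin N`. -/
structure StandardTableau (N : ℕ) (D : Finset (ℕ × ℕ)) where
  entry : {b : ℕ × ℕ // b ∈ D} ≃ Fin N
  row_lt : ∀ a b, a.1.1 = b.1.1 → a.1.2 < b.1.2 → entry a < entry b
  col_lt : ∀ a b, a.1.2 = b.1.2 → a.1.1 < b.1.1 → entry a < entry b

/-- The standard ribbon tableaux with `N` boxes: a ribbon and a standard filling of it. -/
structure RibbonTableau (N : ℕ) where
  shape : RibbonClass N
  filling : StandardTableau N shape.diagram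

/-- The column coordinate of the box of a tableau that contains a given entry. -/
def RibbonTableau.column {N : ℕ} (T : RibbonTableau N) (e : Fin N) : ℕ :=
  (T.filling.entry.symm e).1.2

/-- The form `[n_1 ⋯ n_N]` that encodes a tableau when its entries are read in the order
`σ(1), …, σ(N)`: `n_i` is the column coordinate of the box that contains `σ(i)`.
The backward reading is `σ = Fin.revPerm`. -/
noncomputable def readingForm (K : Type*) [Field K] {N : ℕ} (σ : Equiv.Perm (Fin N))
    (T : RibbonTableau N) : MvPolynomial (Fin N) K :=
  cvForm K fun i => T.column (σ i)

end ConfluentVandermonde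

namespace ConfluentVandermonde

/-! ### Monomial expansion and support of cv-forms -/

section

open MvPolynomial

/-! The space of harmonics is caught between two counts of `N!`. Every cv-form is harmonic: `∂_j ^
k` changes only column `j`, where it acts as a shift of the rows, so the symmetrized derivative
multiplies the determinant by the trace of a nilpotent matrix. From above, harmonics pair to zero
with the ideal of the power sums, so their dimension is at most that of the coinvariant algebra.
There the elements `-x_i` are the `N` roots of `X ^ N`, and adjoining them one by one shows that
`N!` elements span.

From below, reading a ribbon from the lower left to the upper right identifies tableaux with
permutations, the descents giving the shape. The monomial `t ^ b` occurs in `[n_1 ⋯ n_N]` exactly if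
`n - b` is a permutation of `0, …, N - 1`. Taking for `b` the row coordinates of a tableau yields a
matrix of coefficients that is triangular with respect to `wordWeight`; this is the rearrangement
inequality (`wordWeight_le_and_eq`). So each reading order gives `N!` independent forms, hence a
basis.

To tell the bases apart, let `κ` be the relabelling of entries that compares two reading orders. For
`N ≥ 3` the supports in degree 1 force `κ` to fix the least entry, and those in degree 2 force its
inverse to preserve the order of the others. For `N = 2` the constant in degree 0, the sign of the
reading order, decides. -/

theorem prod_cvForm_entries (K : Type*) [Field K] {N : ℕ} (n : Fin N → ℕ)
    (π : Equiv.Perm (Fin N)) :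
    (∏ j, if (π j : ℕ) ≤ n j then
      C ((((n j - (π j : ℕ)).factorial : ℕ) : K)⁻¹) * X j ^ (n j - (π j : ℕ)) else 0) =
    if ∀ j, (π j : ℕ) ≤ n j then
      monomial (Finsupp.equivFunOnFinite.symm fun j => n j - (π j : ℕ))
        (∏ j, (((n j - (π j : ℕ)).factorial : ℕ) : K)⁻¹)
    else (0 : MvPolynomial (Fin N) K) := by
  split_ifs with h
  · rw [monomial_eq, map_prod, Finsupp.prod_fintype _ _ (by simp), ← Finset.prod_mul_distrib]
    exact Finset.prod_congr rfl fun j _ => by simp [h j]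
  · push Not at h
    obtain ⟨j, hj⟩ := h
    exact Finset.prod_eq_zero (Finset.mem_univ j) (by simp [hj])

theorem cvForm_eq_sum_monomial (K : Type*) [Field K] {N : ℕ} (n : Fin N → ℕ) :
    cvForm K n = ∑ π : Equiv.Perm (Fin N), Equiv.Perm.sign π •
      if ∀ j, (π j : ℕ) ≤ n j then
        monomial (Finsupp.equivFunOnFinite.symm fun j => n j - (π j : ℕ))
          (∏ j, (((n j - (π j : ℕ)).factorial : ℕ) : K)⁻¹)
      else 0 := by
  rw [cvForm, Matrix.det_apply]
  refine Finset.sum_congr rfl fun π _ => ?_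
  rw [← prod_cvForm_entries]
  rfl

/-- The coefficient of `t ^ b` in `[n_1 ⋯ n_N]` if `n - b` is a permutation. -/
theorem coeff_cvForm_of_eq_add (K : Type*) [Field K] {N : ℕ} {n : Fin N → ℕ} {b : Fin N →₀ ℕ}
    {π : Equiv.Perm (Fin N)} (h : ∀ j, n j = b j + (π j : ℕ)) :
    coeff b (cvForm K n) = ((Equiv.Perm.sign π : ℤ) : K) * ∏ j, (((b j).factorial : ℕ) : K)⁻¹ := by
  rw [cvForm_eq_sum_monomial, coeff_sum, Finset.sum_eq_single π]
  · have hb : (Finsupp.equivFunOnFinite.symm fun j => n j - (π j : ℕ)) = b := by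
      ext j; simp [h]
    rw [if_pos fun j => by simp [h], hb]
    rw [Units.smul_def, coeff_smul, coeff_monomial, if_pos rfl, zsmul_eq_mul]
    simp [h]
  · intro ρ _ hρ
    rw [Units.smul_def, coeff_smul]
    split_ifs with hle
    · rw [coeff_monomial, if_neg, smul_zero]
      rintro rfl
      apply hρ
      ext j
      have := h j
      have := hle j
      simp only [Finsupp.equivFunOnFinite_symm_apply_apply] at *
      omega
    · simp
  · simp

theorem exists_of_coeff_cvForm_ne_zero (K : Type*) [Field K] {N : ℕ} {n : Fin N → ℕ}
    {b : Fin N →₀ ℕ} (h : coeff b (cvForm K n) ≠ 0) :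
    ∃ π : Equiv.Perm (Fin N), ∀ j, n j = b j + (π j : ℕ) := by
  rw [cvForm_eq_sum_monomial, coeff_sum] at h
  obtain ⟨π, -, hπ⟩ := Finset.exists_ne_zero_of_sum_ne_zero h
  refine ⟨π, fun j => ?_⟩
  rw [Units.smul_def, coeff_smul] at hπ
  split_ifs at hπ with hle
  · rw [coeff_monomial] at hπ
    split_ifs at hπ with hb
    · have := hle j
      subst hb
      simp only [Finsupp.equivFunOnFinite_symm_apply_apply]
      omega
    · simp at hπ
  · simp at hπ

/-- The support of `[n_1 ⋯ n_N]` consists of the exponents that differ from `n` by a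
permutation. -/
theorem coeff_cvForm_ne_zero_iff (K : Type*) [Field K] [CharZero K] {N : ℕ} {n : Fin N → ℕ}
    {b : Fin N →₀ ℕ} :
    coeff b (cvForm K n) ≠ 0 ↔ ∃ π : Equiv.Perm (Fin N), ∀ j, n j = b j + (π j : ℕ) := by
  refine ⟨exists_of_coeff_cvForm_ne_zero K, ?_⟩
  rintro ⟨π, hπ⟩
  rw [coeff_cvForm_of_eq_add K hπ]
  refine mul_ne_zero ?_ (Finset.prod_ne_zero_iff.2 fun j _ => ?_)
  · exact_mod_cast (Equiv.Perm.sign π).ne_zero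
  · exact inv_ne_zero (by exact_mod_cast (b j).factorial_ne_zero)

theorem cvForm_isHomogeneous (K : Type*) [Field K] {N d : ℕ} {n : Fin N → ℕ}
    (h : ∑ j, n j = d + ∑ j : Fin N, (j : ℕ)) : (cvForm K n).IsHomogeneous d := by
  intro b hb
  obtain ⟨π, hπ⟩ := exists_of_coeff_cvForm_ne_zero K hb
  have h1 : ∑ j, n j = ∑ j, b j + ∑ j : Fin N, (j : ℕ) := by
    rw [← Equiv.sum_comp π (fun j : Fin N => (j : ℕ)), ← Finset.sum_add_distrib]
    exact Finset.sum_congr rfl fun j _ => hπ j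
  rw [Finsupp.weight_apply, Finsupp.sum_fintype _ _ (by simp)]
  simp
  omega

end

/-! ### Cv-forms are harmonic -/

section

open MvPolynomial

/-- The `i`-th entry of the column of a cv-form with entry `m` and variable `j`. -/
noncomputable def columnEntry (K : Type*) [Field K] {N : ℕ} (j : Fin N) (m i : ℕ) :
    MvPolynomial (Fin N) K :=
  if i ≤ m then C ((((m - i).factorial : ℕ) : K)⁻¹) * X j ^ (m - i) else 0

/-- Divided powers differentiate to divided powers, so each row of a column is the derivative of the
row above it. -/
theorem pderiv_columnEntry (K : Type*) [Field K] [CharZero K] {N : ℕ} (j : Fin N) (m i : ℕ) :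
    pderiv j (columnEntry K j m i) = columnEntry K j m (i + 1) := by
  unfold columnEntry
  rcases lt_trichotomy i m with h | rfl | h
  · obtain ⟨d, rfl⟩ := Nat.exists_eq_add_of_lt h
    have h1 : i + d + 1 - i = d + 1 := by omega
    have h2 : i + d + 1 - (i + 1) = d := by omega
    rw [if_pos (by omega), if_pos (by omega), h1, h2, pderiv_C_mul, pderiv_pow, pderiv_X_self,
      Nat.add_sub_cancel, mul_one, ← mul_assoc]
    congr 1
    rw [← map_natCast (C : K →+* MvPolynomial (Fin N) K), ← map_mul, Nat.factorial_succ]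
    congr 1
    have := (Nat.cast_add_one_ne_zero d : (d : K) + 1 ≠ 0)
    have : ((d.factorial : ℕ) : K) ≠ 0 := by exact_mod_cast d.factorial_ne_zero
    push_cast
    field_simp
  · simp
  · rw [if_neg (by omega), if_neg (by omega), map_zero]

theorem pderiv_columnEntry_of_ne (K : Type*) [Field K] {N : ℕ} {j l : Fin N} (h : l ≠ j)
    (m i : ℕ) : pderiv j (columnEntry K l m i) = 0 := by
  unfold columnEntry
  split_ifs
  · simp [pderiv_X_of_ne h]
  · simp

/-- The partial derivative `∂ / ∂ t_j` as an endomorphism. -/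
noncomputable abbrev partialEnd (R : Type*) [CommSemiring R] {σ : Type*} (j : σ) :
    Module.End R (MvPolynomial σ R) :=
  ((pderiv j : Derivation R (MvPolynomial σ R) (MvPolynomial σ R)) :
    Module.End R (MvPolynomial σ R))

theorem partialEnd_pow_columnEntry (K : Type*) [Field K] [CharZero K] {N : ℕ} (j : Fin N)
    (k m i : ℕ) : (partialEnd K j ^ k) (columnEntry K j m i) = columnEntry K j m (i + k) := by
  induction k with
  | zero => simp
  | succ k ih =>
    rw [pow_succ', Module.End.mul_apply, ih]
    exact pderiv_columnEntry K j m (i + k)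

theorem partialEnd_pow_mul_of_eq_zero {R σ : Type*} [CommSemiring R] (j : σ) (k : ℕ)
    {p : MvPolynomial σ R} (hp : pderiv j p = 0) (q : MvPolynomial σ R) :
    (partialEnd R j ^ k) (p * q) = p * (partialEnd R j ^ k) q := by
  induction k with
  | zero => simp
  | succ k ih => rw [pow_succ', Module.End.mul_apply, ih, Module.End.mul_apply]; simp [hp]

theorem pderiv_prod_eq_zero {R σ ι : Type*} [CommSemiring R] (j : σ) (s : Finset ι)
    {f : ι → MvPolynomial σ R} (h : ∀ i ∈ s, pderiv j (f i) = 0) :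
    pderiv j (∏ i ∈ s, f i) = 0 := by
  classical
  induction s using Finset.induction_on with
  | empty => simp
  | insert a s ha ih =>
    rw [Finset.prod_insert ha, pderiv_mul, h a (by simp),
      ih fun i hi => h i (Finset.mem_insert_of_mem hi)]
    simp

/-- If only one column depends on a variable, then a determinant is differentiated in this
variable by differentiating that column. -/
theorem partialEnd_pow_det {R ι σ : Type*} [CommRing R] [Fintype ι] [DecidableEq ι]
    (A : Matrix ι ι (MvPolynomial σ R)) (j : σ) (c : ι) (k : ℕ)
    (h : ∀ i l, l ≠ c → pderiv j (A i l) = 0) :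
    (partialEnd R j ^ k) A.det = (A.updateCol c fun i => (partialEnd R j ^ k) (A i c)).det := by
  rw [Matrix.det_apply, Matrix.det_apply, map_sum]
  refine Finset.sum_congr rfl fun π _ => ?_
  rw [Units.smul_def, Units.smul_def, map_zsmul]
  congr 1
  -- The factors outside column `c` are constants for `∂_j` and can be pulled out.
  rw [← Finset.prod_erase_mul _ _ (Finset.mem_univ c),
    ← Finset.prod_erase_mul _ _ (Finset.mem_univ c), partialEnd_pow_mul_of_eq_zero]
  · rw [Matrix.updateCol_self]
    congr 1
    refine Finset.prod_congr rfl fun l hl => ?_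
    rw [Matrix.updateCol_ne (Finset.ne_of_mem_erase hl)]
  · exact pderiv_prod_eq_zero j _ fun l hl => h _ _ (Finset.ne_of_mem_erase hl)

/-- Applying an endomorphism to one column after the other multiplies the determinant with the
trace. -/
theorem sum_det_updateCol_mulVec {R ι : Type*} [CommRing R] [Fintype ι] [DecidableEq ι]
    (A S : Matrix ι ι R) :
    ∑ j, (A.updateCol j (S.mulVec fun i => A i j)).det = S.trace * A.det := by
  -- Cramer's rule turns each summand into a diagonal entry; cyclicity of the trace then brings `A`
  -- next to its adjugate.
  have h : ∀ j, (A.updateCol j (S.mulVec fun i => A i j)).det = (A.adjugate * (S * A)) j j := by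
    intro j
    rw [← Matrix.cramer_apply, Matrix.cramer_eq_adjugate_mulVec, Matrix.mul_apply]
    rfl
  calc _ = (A.adjugate * (S * A)).trace := Finset.sum_congr rfl fun j _ => h j
    _ = _ := by
      rw [Matrix.trace_mul_comm, Matrix.mul_assoc, Matrix.mul_adjugate, Matrix.mul_smul,
        Matrix.mul_one, Matrix.trace_smul, smul_eq_mul, mul_comm]

/-- Differentiating `k + 1` times in `t_j` applies the shift `S` by `k + 1` rows to column `j`.
Summed over `j` this gives `S.trace * A.det`, and `S` has zero diagonal. -/
theorem cvForm_mem_harmonics (K : Type*) [Field K] [CharZero K] {N : ℕ} {n : Fin N → ℕ}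
    (hn : ∀ j, n j < N) : cvForm K n ∈ harmonics K N := by
  rw [harmonics, Submodule.mem_iInf]
  intro k
  rw [LinearMap.mem_ker, symmDeriv, LinearMap.sum_apply]
  set A : Matrix (Fin N) (Fin N) (MvPolynomial (Fin N) K) :=
    Matrix.of fun i j => columnEntry K j (n j) i with hA
  let S : Matrix (Fin N) (Fin N) (MvPolynomial (Fin N) K) :=
    Matrix.of fun i l => if (l : ℕ) = i + (k + 1) then 1 else 0
  have hS : S.trace = 0 := Finset.sum_eq_zero fun i _ => by simp [S]
  have key : ∀ j, (partialEnd K j ^ (k + 1)) A.det =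
      (A.updateCol j (S.mulVec fun i => A i j)).det := by
    intro j
    rw [partialEnd_pow_det A j j (k + 1) fun i l hl => pderiv_columnEntry_of_ne K hl _ _]
    congr 2
    funext i
    rw [hA, Matrix.of_apply, partialEnd_pow_columnEntry, Matrix.mulVec, dotProduct]
    by_cases hi : (i : ℕ) + (k + 1) < N
    · rw [Finset.sum_eq_single ⟨(i : ℕ) + (k + 1), hi⟩]
      · simp [S]
      · intro l _ hl
        have : (l : ℕ) ≠ i + (k + 1) := fun h => hl (Fin.ext h)
        simp [S, this]
      · simp
    -- Entries that would come from below the last row vanish because `n j < N`.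
    · rw [Finset.sum_eq_zero, columnEntry, if_neg (by have := hn j; omega)]
      intro l _
      have : (l : ℕ) ≠ i + (k + 1) := by omega
      simp [S, this]
  have := sum_det_updateCol_mulVec A S
  rw [hS, zero_mul] at this
  rw [← this]
  exact Finset.sum_congr rfl fun j _ => key j

theorem cvSpan_le_harmonics (K : Type*) [Field K] [CharZero K] (N : ℕ) :
    cvSpan K N ≤ harmonics K N := by
  rw [cvSpan, Submodule.span_le]
  rintro _ ⟨n, rfl⟩
  exact cvForm_mem_harmonics K fun j => (n j).2

end

/-! ### Algebras generated by the roots of a monic polynomial -/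

section RootSpan

open Polynomial
open scoped Pointwise

/-- An algebra that is generated by one root of a monic polynomial of degree `d` is spanned by
`d` elements. -/
theorem exists_finset_span_of_adjoin_singleton {R A : Type*} [CommRing R] [CommRing A]
    [Algebra R A] {x : A} {p : R[X]} (hp : p.Monic) (hx : aeval x p = 0)
    (htop : Algebra.adjoin R {x} = ⊤) :
    ∃ s : Finset A, s.card ≤ p.natDegree ∧ Submodule.span R (s : Set A) = ⊤ := by
  classical
  refine ⟨(Finset.range p.natDegree).image fun i => x ^ i,
    Finset.card_image_le.trans (by simp), ?_⟩
  rw [eq_top_iff]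
  intro y _
  have hy : y ∈ Algebra.adjoin R {x} := htop ▸ Algebra.mem_top
  rw [Algebra.adjoin_singleton_eq_range_aeval] at hy
  obtain ⟨q, rfl⟩ := hy
  change aeval x q ∈ _
  rcases subsingleton_or_nontrivial R with hR | hR
  · rw [Subsingleton.elim q 0, map_zero]; exact Submodule.zero_mem _
  -- Only the remainder modulo `p` matters, and its coefficients vanish from degree `p.natDegree`
  -- on.
  rw [← aeval_modByMonic_eq_self_of_root hx, aeval_eq_sum_range]
  refine Submodule.sum_mem _ fun i hi => ?_
  by_cases hi' : i < p.natDegree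
  · exact Submodule.smul_mem _ _ (Submodule.subset_span (by
      rw [Finset.coe_image]; exact ⟨i, by simpa using hi', rfl⟩))
  · rw [coeff_eq_zero_of_degree_lt, zero_smul]
    · exact Submodule.zero_mem _
    · refine (degree_modByMonic_lt q hp).trans_le ?_
      rw [degree_eq_natDegree hp.ne_zero]
      exact_mod_cast not_lt.1 hi'

theorem adjoin_adjoin_range_succ {A : Type*} [CommRing A] {m : ℕ} (R : Type*) [CommRing R]
    [Algebra R A] (x : Fin (m + 1) → A) (h : Algebra.adjoin R (Set.range x) = ⊤) :
    Algebra.adjoin (Algebra.adjoin R {x 0}) (Set.range fun i : Fin m => x i.succ) = ⊤ := by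
  apply Subalgebra.restrictScalars_injective R
  rw [← Algebra.adjoin_union_eq_adjoin_adjoin, Subalgebra.restrictScalars_top, ← h]
  congr 1
  rw [Set.singleton_union]
  exact (Fin.range_cons (x 0) fun i : Fin m => x i.succ).symm.trans
    (congrArg Set.range (Fin.cons_self_tail x))

theorem adjoin_singleton_self {A : Type*} [CommRing A] (R : Type*) [CommRing R]
    [Algebra R A] (a : A) :
    Algebra.adjoin R {(⟨a, Algebra.subset_adjoin rfl⟩ : Algebra.adjoin R {a})} = ⊤ := by
  rw [← Algebra.adjoin_adjoin_coe_preimage (s := {a})]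
  congr 1
  ext b
  simp [Subtype.ext_iff]

/-- An algebra that is generated by the `m` roots of a monic polynomial of degree `m` is spanned
by `m !` elements. -/
theorem exists_finset_span_of_adjoin_roots.{u} {A : Type u} [CommRing A] (m : ℕ) :
    ∀ (R : Type u) [CommRing R] [Algebra R A] (x : Fin m → A) (p : R[X]),
      p.Monic → p.natDegree = m → p.map (algebraMap R A) = ∏ i, (X - C (x i)) →
      Algebra.adjoin R (Set.range x) = ⊤ →
      ∃ s : Finset A, s.card ≤ m.factorial ∧ Submodule.span R (s : Set A) = ⊤ := by
  classical
  induction m with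
  | zero =>
    intro R _ _ x p _ _ _ htop
    refine ⟨{1}, by simp, ?_⟩
    rw [Set.range_eq_empty, Algebra.adjoin_empty] at htop
    rw [Finset.coe_singleton, ← Submodule.one_eq_span, ← Algebra.toSubmodule_bot, htop,
      Algebra.top_toSubmodule]
  | succ m ih =>
    intro R _ _ x p hp hdeg hmap htop
    rcases subsingleton_or_nontrivial A with hA | hA
    · exact ⟨∅, by simp, Subsingleton.elim _ _⟩
    have : Nontrivial R := (algebraMap R A).domain_nontrivial
    -- Over `B = R[x 0]` the factor `X - x 0` splits off. The quotient `Q` has the other `m` roots,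
    -- so `A` needs at most `m!` generators over `B`, and `B` at most `m + 1` over `R`.
    let B := Algebra.adjoin R {x 0}
    let y : B := ⟨x 0, Algebra.subset_adjoin rfl⟩
    let P : B[X] := p.map (algebraMap R B)
    have hy : P.IsRoot y := by
      have : (P.map (algebraMap B A)).IsRoot (algebraMap B A y) := by
        rw [Polynomial.map_map, ← IsScalarTower.algebraMap_eq, hmap, Fin.prod_univ_succ]
        simp [y]
      rw [IsRoot, eval_map_algebraMap, aeval_algebraMap_apply] at this
      have := (FaithfulSMul.algebraMap_injective B A) (this.trans (map_zero _).symm)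
      simpa [IsRoot] using this
    have hdiv := mul_divByMonic_eq_iff_isRoot.2 hy
    set Q := P /ₘ (X - C y) with hQ
    have hPm : P.Monic := hp.map _
    have hQm : Q.Monic := by
      rw [← hdiv] at hPm; exact (monic_X_sub_C y).of_mul_monic_left hPm
    have hQd : Q.natDegree = m := by
      rw [hQ, natDegree_divByMonic _ (monic_X_sub_C y), natDegree_X_sub_C]
      simp [P, hp.natDegree_map, hdeg]
    have hQmap : Q.map (algebraMap B A) = ∏ i, (X - C (x (Fin.succ i))) := by
      -- `A` may have zero divisors, but the monic factor `X - C (x 0)` is regular and can be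
      -- cancelled.
      have h1 : (X - C (x 0)) * Q.map (algebraMap B A) =
          (X - C (x 0)) * ∏ i, (X - C (x (Fin.succ i))) := by
        rw [← Fin.prod_univ_succ (fun i => X - C (x i)), ← hmap,
          IsScalarTower.algebraMap_eq R B A, ← Polynomial.map_map]
        change _ = P.map _
        rw [← hdiv, Polynomial.map_mul]
        simp [y]
      exact (monic_X_sub_C (x 0)).isRegular.left h1
    obtain ⟨s, hs, hs'⟩ := ih B (fun i => x i.succ) Q hQm hQd hQmap
      (adjoin_adjoin_range_succ R x htop)
    obtain ⟨t, ht, ht'⟩ := exists_finset_span_of_adjoin_singleton (A := B) (x := y) hp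
      (by rw [IsRoot, eval_map_algebraMap] at hy; exact hy) (adjoin_singleton_self R (x 0))
    refine ⟨Finset.image₂ (fun (b : B) (a : A) => b • a) t s, ?_, ?_⟩
    · refine (Finset.card_image₂_le _ _ _).trans ?_
      rw [Nat.factorial_succ]
      exact Nat.mul_le_mul (ht.trans hdeg.le) hs
    · rw [Finset.coe_image₂]
      change Submodule.span R ((t : Set B) • (s : Set A)) = ⊤
      rw [Submodule.span_smul_of_span_eq_top ht', hs', Submodule.restrictScalars_top]

end RootSpan

/-! ### The coinvariant algebra and the dimension bound for harmonics -/

section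

open MvPolynomial

/-- The ideal generated by the power sums of positive degree. -/
noncomputable def psumIdeal (K : Type*) [Field K] (N : ℕ) : Ideal (MvPolynomial (Fin N) K) :=
  Ideal.span (Set.range fun k : ℕ => psum (Fin N) K (k + 1))

/-- Newton's identity writes `k * e_k` with power sums of positive degree, and `k` is invertible in
characteristic 0. -/
theorem esymm_mem_psumIdeal (K : Type*) [Field K] [CharZero K] (N k : ℕ) (hk : 0 < k) :
    esymm (Fin N) K k ∈ psumIdeal K N := by
  have h : (k : MvPolynomial (Fin N) K) * esymm (Fin N) K k ∈ psumIdeal K N := by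
    rw [mul_esymm_eq_sum]
    refine Ideal.mul_mem_left _ _ (Ideal.sum_mem _ fun a ha => Ideal.mul_mem_left _ _ ?_)
    rw [Finset.mem_filter, Finset.HasAntidiagonal.mem_antidiagonal] at ha
    refine Ideal.subset_span ⟨a.2 - 1, ?_⟩
    simp only
    congr 1
    omega
  have h2 := Ideal.mul_mem_left (psumIdeal K N) (C ((k : K)⁻¹)) h
  have hk' : (k : K) ≠ 0 := by exact_mod_cast hk.ne'
  rwa [← mul_assoc, ← map_natCast (C : K →+* MvPolynomial (Fin N) K), ← map_mul,
    inv_mul_cancel₀ hk', map_one, one_mul] at h2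

/-- The product is `∏ (X + x_i)`, whose coefficients other than the leading one are elementary
symmetric polynomials and so vanish in the quotient. The roots are taken as `-x_i` to avoid
alternating signs. -/
theorem prod_X_sub_C_mk_eq (K : Type*) [Field K] [CharZero K] (N : ℕ) :
    ∏ i : Fin N, (Polynomial.X - Polynomial.C
      (-(Ideal.Quotient.mk (psumIdeal K N) (X i)))) = Polynomial.X ^ N := by
  have h := congrArg (Polynomial.map (Ideal.Quotient.mk (psumIdeal K N)))
    (MvPolynomial.prod_C_add_X_eq_sum_esymm (R := K) (σ := Fin N))
  rw [Polynomial.map_prod, Polynomial.map_sum, Finset.sum_eq_single 0] at h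
  · simpa using h
  · intro k _ hk
    rw [Polynomial.map_mul, Polynomial.map_C,
      Ideal.Quotient.eq_zero_iff_mem.2 (esymm_mem_psumIdeal K N k (Nat.pos_of_ne_zero hk))]
    simp
  · simp

/-- The coinvariant algebra is spanned by `N !` elements. -/
theorem exists_finset_span_coinvariants (K : Type*) [Field K] [CharZero K] (N : ℕ) :
    ∃ s : Finset (MvPolynomial (Fin N) K ⧸ psumIdeal K N), s.card ≤ N.factorial ∧
      Submodule.span K (s : Set (MvPolynomial (Fin N) K ⧸ psumIdeal K N)) = ⊤ := by
  refine exists_finset_span_of_adjoin_roots N K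
    (fun i => -(Ideal.Quotient.mk (psumIdeal K N) (X i))) (Polynomial.X ^ N)
    (Polynomial.monic_X_pow N) (by simp) (by rw [prod_X_sub_C_mk_eq]; simp) ?_
  rw [eq_top_iff]
  rintro a -
  obtain ⟨q, rfl⟩ := Ideal.Quotient.mk_surjective a
  induction q using MvPolynomial.induction_on with
  | C r => exact Subalgebra.algebraMap_mem _ r
  | add p q hp hq => rw [map_add]; exact Subalgebra.add_mem _ hp hq
  | mul_X p i hp =>
    rw [map_mul]
    refine Subalgebra.mul_mem _ hp ?_
    rw [← neg_neg (Ideal.Quotient.mk (psumIdeal K N) (X i))]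
    exact Subalgebra.neg_mem _ (Algebra.subset_adjoin ⟨i, rfl⟩)

/-- The pairing of `q` and `f` is the value at `0` of `q (∂ / ∂ t) f`. -/
noncomputable def diffPairing (K : Type*) [Field K] (N : ℕ) :
    MvPolynomial (Fin N) K →ₗ[K] MvPolynomial (Fin N) K →ₗ[K] K :=
  (basisMonomials (Fin N) K).constr K fun a =>
    (∏ i, (((a i).factorial : ℕ) : K)) • lcoeff K a

theorem diffPairing_monomial (K : Type*) [Field K] {N : ℕ} (a : Fin N →₀ ℕ)
    (f : MvPolynomial (Fin N) K) :
    diffPairing K N (monomial a 1) f = (∏ i, (((a i).factorial : ℕ) : K)) * coeff a f := by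
  have := (basisMonomials (Fin N) K).constr_basis K (fun a : Fin N →₀ ℕ =>
    (∏ i, (((a i).factorial : ℕ) : K)) • lcoeff K a) a
  rw [coe_basisMonomials] at this
  rw [diffPairing, this]
  rfl

/-- Multiplication by `t_i` is adjoint to `∂ / ∂ t_i`; on monomials this is `(a + 1)! = (a + 1) *
a!`. -/
theorem diffPairing_mul_X (K : Type*) [Field K] {N : ℕ} (i : Fin N)
    (q f : MvPolynomial (Fin N) K) :
    diffPairing K N (q * X i) f = diffPairing K N q (pderiv i f) := by
  suffices h : (diffPairing K N).flip f ∘ₗ LinearMap.mulRight K (X i) =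
      (diffPairing K N).flip (pderiv i f) from LinearMap.congr_fun h q
  refine (basisMonomials (Fin N) K).ext fun a => ?_
  simp only [coe_basisMonomials, LinearMap.comp_apply, LinearMap.mulRight_apply,
    LinearMap.flip_apply]
  rw [X, monomial_mul, one_mul, diffPairing_monomial, diffPairing_monomial, coeff_pderiv,
    ← Finset.mul_prod_erase _ _ (Finset.mem_univ i), ← Finset.mul_prod_erase _ _ (Finset.mem_univ i)]
  have h : ∏ j ∈ Finset.univ.erase i, ((((a + Finsupp.single i 1 : Fin N →₀ ℕ) j).factorial : ℕ) : K) =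
      ∏ j ∈ Finset.univ.erase i, (((a j).factorial : ℕ) : K) :=
    Finset.prod_congr rfl fun j hj => by
      rw [Finsupp.add_apply, Finsupp.single_eq_of_ne (Finset.ne_of_mem_erase hj), add_zero]
  rw [h, Finsupp.add_apply, Finsupp.single_eq_same, Nat.factorial_succ]
  push_cast
  ring

theorem diffPairing_mul_X_pow (K : Type*) [Field K] {N : ℕ} (i : Fin N) (k : ℕ)
    (q f : MvPolynomial (Fin N) K) :
    diffPairing K N (q * X i ^ k) f = diffPairing K N q ((partialEnd K i ^ k) f) := by
  induction k generalizing f with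
  | zero => simp
  | succ k ih =>
    rw [pow_succ, ← mul_assoc, diffPairing_mul_X, ih, pow_succ, Module.End.mul_apply]
    rfl

theorem diffPairing_mul_psum (K : Type*) [Field K] (N k : ℕ) (q f : MvPolynomial (Fin N) K) :
    diffPairing K N (q * psum (Fin N) K k) f = diffPairing K N q (symmDeriv K N k f) := by
  rw [psum, Finset.mul_sum, map_sum, LinearMap.sum_apply, symmDeriv, LinearMap.sum_apply, map_sum]
  exact Finset.sum_congr rfl fun i _ => diffPairing_mul_X_pow K i k q f

theorem diffPairing_eq_zero_of_mem (K : Type*) [Field K] {N : ℕ} {q f : MvPolynomial (Fin N) K}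
    (hq : q ∈ psumIdeal K N) (hf : f ∈ harmonics K N) : diffPairing K N q f = 0 := by
  -- The pairing is only `K`-linear; quantifying over `r` absorbs the polynomial coefficients of the
  -- ideal.
  suffices h : ∀ r, diffPairing K N (r * q) f = 0 by simpa using h 1
  refine Submodule.span_induction ?_ (by simp) ?_ ?_ hq
  · rintro _ ⟨k, rfl⟩ r
    rw [harmonics, Submodule.mem_iInf] at hf
    rw [diffPairing_mul_psum, LinearMap.mem_ker.1 (hf k), map_zero]
  · intro p q _ _ hp hq r
    rw [mul_add, map_add, LinearMap.add_apply, hp, hq, add_zero]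
  · intro a p _ hp r
    rw [smul_eq_mul, ← mul_assoc]
    exact hp _

theorem eq_zero_of_diffPairing_eq_zero (K : Type*) [Field K] [CharZero K] {N : ℕ}
    {f : MvPolynomial (Fin N) K} (hf : ∀ q, diffPairing K N q f = 0) : f = 0 := by
  ext a
  have := hf (monomial a 1)
  rw [diffPairing_monomial] at this
  exact (mul_eq_zero.1 this).resolve_left
    (Finset.prod_ne_zero_iff.2 fun j _ => by exact_mod_cast (a j).factorial_ne_zero)

theorem finite_and_finrank_harmonics_le (K : Type*) [Field K] [CharZero K] (N : ℕ) :
    Module.Finite K (harmonics K N) ∧ Module.finrank K (harmonics K N) ≤ N.factorial := by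
  obtain ⟨s, hs, hs'⟩ := exists_finset_span_coinvariants K N
  let g : harmonics K N →ₗ[K] s → K := LinearMap.pi fun a =>
    diffPairing K N (Function.surjInv Ideal.Quotient.mk_surjective a.1) ∘ₗ (harmonics K N).subtype
  have hg : Function.Injective g := by
    rw [← LinearMap.ker_eq_bot, LinearMap.ker_eq_bot']
    intro f hf
    apply Subtype.ext
    refine eq_zero_of_diffPairing_eq_zero K fun q => ?_
    -- The polynomials pairing to zero with `f` contain lifts of the spanning set, so every `q` is
    -- congruent to one of them modulo an ideal that itself pairs to zero with `f`.
    have hle : ⊤ ≤ (LinearMap.ker ((diffPairing K N).flip f.1)).map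
        (Ideal.Quotient.mkₐ K (psumIdeal K N)).toLinearMap := by
      rw [← hs', Submodule.span_le]
      exact fun a ha => ⟨Function.surjInv Ideal.Quotient.mk_surjective a, congrFun hf ⟨a, ha⟩,
        Function.surjInv_eq Ideal.Quotient.mk_surjective a⟩
    obtain ⟨p, hp, hpq⟩ := hle (Submodule.mem_top (x := Ideal.Quotient.mk (psumIdeal K N) q))
    have h := diffPairing_eq_zero_of_mem K (Ideal.Quotient.eq.1 hpq) f.2
    rwa [map_sub, LinearMap.sub_apply, show diffPairing K N p f.1 = 0 from hp, zero_sub,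
      neg_eq_zero] at h
  refine ⟨Module.Finite.of_injective g hg, (LinearMap.finrank_le_finrank_of_injective hg).trans ?_⟩
  simpa using hs

end

/-! ### Ribbon tableaux correspond to permutations -/

theorem strictMono_of_lt_next {N : ℕ} {α : Type*} [Preorder α] {f : Fin N → α}
    (h : ∀ i j : Fin N, (i : ℕ) + 1 = j → f i < f j) : StrictMono f := by
  cases N with
  | zero => exact fun i => i.elim0
  | succ N => exact Fin.strictMono_iff_lt_succ.2 fun i => h _ _ (by simp)

theorem perm_eq_one_of_strictMono {N : ℕ} {π : Equiv.Perm (Fin N)} (h : StrictMono π) :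
    π = 1 := by
  ext i
  have := Subsingleton.elim (h.orderIsoOfRightInverse π π.symm π.apply_symm_apply)
    (OrderIso.refl (Fin N))
  exact congrArg Fin.val (DFunLike.congr_fun this i)

/-- A word is compatible with a ribbon class if its descents are the places at which the
class decreases. -/
def Compatible {N : ℕ} (c : RibbonClass N) (w : Equiv.Perm (Fin N)) : Prop :=
  ∀ i j : Fin N, (i : ℕ) + 1 = j →
    (c.part i = c.part j → w i < w j) ∧ (c.part i = c.part j + 1 → w j < w i)

theorem RibbonClass.part_eq_or {N : ℕ} (c : RibbonClass N) {i j : Fin N} (h : (i : ℕ) + 1 = j) :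
    c.part i = c.part j ∨ c.part i = c.part j + 1 := by
  have h1 := c.step i j h
  have h2 := c.antitone (show i ≤ j by rw [Fin.le_def]; omega)
  omega

/-- Entries are less than `N`, so `N * row - entry` orders by row first and breaks ties by the
entry. Its companion `Compatible.strictMono` does this for columns. Both conditions on standard
fillings and the triangularity of the bases follow from these two. -/
theorem Compatible.strictAnti {N : ℕ} {c : RibbonClass N} {w : Equiv.Perm (Fin N)}
    (h : Compatible c w) : StrictAnti fun i => (N : ℤ) * c.part i - (w i : ℕ) := by
  refine strictMono_of_lt_next (α := ℤᵒᵈ) fun i j hij => ?_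
  change (N : ℤ) * c.part j - (w j : ℕ) < (N : ℤ) * c.part i - (w i : ℕ)
  have hi := (w i).2
  have := h i j hij
  rcases c.part_eq_or hij with he | he
  · have := this.1 he
    rw [Fin.lt_def] at this
    rw [he]
    omega
  · rw [he]
    push_cast
    rw [mul_add]
    omega

theorem Compatible.strictMono {N : ℕ} {c : RibbonClass N} {w : Equiv.Perm (Fin N)}
    (h : Compatible c w) :
    StrictMono fun i : Fin N => (N : ℤ) * ((c.part i + i : ℕ) : ℤ) - (w i : ℕ) := by
  refine strictMono_of_lt_next fun i j hij => ?_
  change (N : ℤ) * ((c.part i + i : ℕ) : ℤ) - (w i : ℕ) <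
    (N : ℤ) * ((c.part j + j : ℕ) : ℤ) - (w j : ℕ)
  have hj := (w j).2
  have := h i j hij
  rcases c.part_eq_or hij with he | he
  · rw [he, ← hij]
    push_cast
    rw [mul_add, mul_add, mul_add]
    omega
  · have := this.2 he
    rw [Fin.lt_def] at this
    rw [he, ← hij, show c.part j + 1 + (i : ℕ) = c.part j + (i + 1) by ring]
    omega

/-- The boxes of a ribbon, from the lower left to the upper right. -/
noncomputable def RibbonClass.box {N : ℕ} (c : RibbonClass N) :
    Fin N ≃ {b : ℕ × ℕ // b ∈ c.diagram} :=
  Equiv.ofBijective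
    (fun i => ⟨(c.part i, c.part i + i), Finset.mem_image_of_mem _ (Finset.mem_univ i)⟩)
    ⟨fun i j h => by
      have h1 := congrArg (fun b => b.1.1) h
      have h2 := congrArg (fun b => b.1.2) h
      simp only at h1 h2
      exact Fin.ext (by omega),
    fun ⟨b, hb⟩ => by
      obtain ⟨i, -, rfl⟩ := Finset.mem_image.1 hb
      exact ⟨i, rfl⟩⟩

theorem RibbonClass.box_coe {N : ℕ} (c : RibbonClass N) (i : Fin N) :
    (c.box i).1 = (c.part i, c.part i + (i : ℕ)) := rfl

/-- The entries of a ribbon tableau, read from the lower left to the upper right. -/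
noncomputable def RibbonTableau.word {N : ℕ} (T : RibbonTableau N) : Equiv.Perm (Fin N) :=
  T.shape.box.trans T.filling.entry

theorem RibbonTableau.column_word {N : ℕ} (T : RibbonTableau N) (i : Fin N) :
    T.column (T.word i) = T.shape.part i + i := by
  simp [RibbonTableau.column, RibbonTableau.word, RibbonClass.box_coe]

theorem RibbonTableau.compatible_word {N : ℕ} (T : RibbonTableau N) :
    Compatible T.shape T.word := by
  refine fun i j hij => ⟨fun h => ?_, fun h => ?_⟩
  · exact T.filling.row_lt (T.shape.box i) (T.shape.box j) h
      (by simp only [RibbonClass.box_coe]; omega)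
  · exact T.filling.col_lt (T.shape.box j) (T.shape.box i)
      (by simp only [RibbonClass.box_coe]; omega) (by simp only [RibbonClass.box_coe]; omega)

/-- The ribbon tableau with a given word. -/
noncomputable def Compatible.tableau {N : ℕ} {c : RibbonClass N} {w : Equiv.Perm (Fin N)}
    (h : Compatible c w) : RibbonTableau N where
  shape := c
  filling :=
    { entry := c.box.symm.trans w
      row_lt := by
        intro a b
        obtain ⟨i, rfl⟩ := c.box.surjective a
        obtain ⟨j, rfl⟩ := c.box.surjective b
        simp only [RibbonClass.box_coe, Equiv.trans_apply, Equiv.symm_apply_apply]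
        intro h1 h2
        have := h.strictAnti (show i < j by rw [Fin.lt_def]; omega)
        simp only [h1] at this
        rw [Fin.lt_def]
        omega
      col_lt := by
        intro a b
        obtain ⟨i, rfl⟩ := c.box.surjective a
        obtain ⟨j, rfl⟩ := c.box.surjective b
        simp only [RibbonClass.box_coe, Equiv.trans_apply, Equiv.symm_apply_apply]
        intro h1 h2
        have := h.strictMono (show j < i by rw [Fin.lt_def]; omega)
        simp only [h1] at this
        rw [Fin.lt_def]
        omega }

theorem Compatible.word_tableau {N : ℕ} {c : RibbonClass N} {w : Equiv.Perm (Fin N)}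
    (h : Compatible c w) : h.tableau.word = w := by
  ext i
  simp [RibbonTableau.word, Compatible.tableau]

/-- Descents fix all differences of consecutive parts and the last part is 0; the induction runs on
the distance `k` from the last position. -/
theorem Compatible.shape_eq {N : ℕ} {c d : RibbonClass N} {w : Equiv.Perm (Fin N)}
    (hc : Compatible c w) (hd : Compatible d w) : c = d := by
  suffices h : ∀ k, ∀ i : Fin N, (i : ℕ) + 1 + k = N → c.part i = d.part i by
    ext i
    exact h (N - (i + 1)) i (by omega)
  intro k
  induction k with
  | zero => intro i hi; rw [c.last i hi, d.last i hi]
  | succ k ih =>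
    intro i hi
    have hij : (i : ℕ) + 1 = (⟨i + 1, by omega⟩ : Fin N) := rfl
    have hj := ih ⟨i + 1, by omega⟩ (by simp only; omega)
    have h1 := hc _ _ hij
    have h2 := hd _ _ hij
    rcases c.part_eq_or hij with e1 | e1 <;> rcases d.part_eq_or hij with e2 | e2
    · omega
    · exact absurd (h1.1 e1) (h2.2 e2).asymm
    · exact absurd (h2.1 e2) (h1.2 e1).asymm
    · omega

theorem RibbonTableau.word_injective {N : ℕ} :
    Function.Injective (RibbonTableau.word : RibbonTableau N → Equiv.Perm (Fin N)) := by
  intro T T' h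
  have hs : T.shape = T'.shape :=
    Compatible.shape_eq T.compatible_word (h ▸ T'.compatible_word)
  obtain ⟨c, ⟨e, h1, h2⟩⟩ := T
  obtain ⟨c', ⟨e', h1', h2'⟩⟩ := T'
  obtain rfl : c = c' := hs
  have : e = e' := by
    refine Equiv.ext fun b => ?_
    obtain ⟨i, rfl⟩ := c.box.surjective b
    exact DFunLike.congr_fun h i
  subst this
  rfl

/-- The class of a ribbon with prescribed descents. -/
def descentClass {N : ℕ} (p : ℕ → Prop) [DecidablePred p] : RibbonClass N where
  part i := ((Finset.Ico (i : ℕ) (N - 1)).filter p).card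
  antitone i j h := Finset.card_le_card
    (Finset.filter_subset_filter _ (Finset.Ico_subset_Ico_left h))
  step i j h := by
    rw [← h, ← Finset.insert_Ico_add_one_left_eq_Ico (a := (i : ℕ)) (b := N - 1) (by omega),
      Finset.filter_insert]
    split_ifs
    · exact Finset.card_insert_le _ _
    · exact Nat.le_succ _
  last i h := by
    rw [Finset.Ico_eq_empty (by omega)]
    rfl

theorem part_descentClass {N : ℕ} (p : ℕ → Prop) [DecidablePred p] {i j : Fin N}
    (h : (i : ℕ) + 1 = j) : (descentClass p : RibbonClass N).part i =
      (descentClass p : RibbonClass N).part j + if p i then 1 else 0 := by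
  simp only [descentClass]
  rw [← h, ← Finset.insert_Ico_add_one_left_eq_Ico (a := (i : ℕ)) (b := N - 1) (by omega),
    Finset.filter_insert]
  split_ifs
  · rw [Finset.card_insert_of_notMem (by simp)]
  · rfl

theorem exists_compatible {N : ℕ} (w : Equiv.Perm (Fin N)) : ∃ c, Compatible c w := by
  classical
  refine ⟨descentClass fun i => ∃ a b : Fin N, (a : ℕ) = i ∧ (b : ℕ) = i + 1 ∧ w b < w a, ?_⟩
  intro i j hij
  rw [part_descentClass _ hij]
  constructor
  · intro h
    rw [Nat.add_eq_left, ite_eq_right_iff] at h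
    have hne : w i ≠ w j := fun he => by
      have := congrArg Fin.val (w.injective he); omega
    exact lt_of_le_of_ne (not_lt.1 fun hlt => absurd (h ⟨i, j, rfl, hij.symm, hlt⟩) one_ne_zero) hne
  · intro h
    have : ∃ a b : Fin N, (a : ℕ) = i ∧ (b : ℕ) = i + 1 ∧ w b < w a := by
      by_contra hn
      rw [if_neg hn] at h
      omega
    obtain ⟨a, b, ha, hb, hab⟩ := this
    rwa [Fin.ext ha, Fin.ext (hb.trans hij)] at hab

theorem RibbonTableau.word_bijective {N : ℕ} :
    Function.Bijective (RibbonTableau.word : RibbonTableau N → Equiv.Perm (Fin N)) :=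
  ⟨RibbonTableau.word_injective, fun w =>
    let ⟨_, h⟩ := exists_compatible w
    ⟨h.tableau, h.word_tableau⟩⟩

theorem card_ribbonTableau (N : ℕ) : Nat.card (RibbonTableau N) = N.factorial := by
  rw [Nat.card_congr (Equiv.ofBijective _ RibbonTableau.word_bijective), Nat.card_perm,
    Nat.card_fin]

instance (N : ℕ) : Finite (RibbonTableau N) :=
  Finite.of_injective _ RibbonTableau.word_injective

theorem RibbonTableau.column_lt {N : ℕ} (T : RibbonTableau N) (e : Fin N) : T.column e < N := by
  obtain ⟨i, rfl⟩ := T.word.surjective e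
  rw [T.column_word]
  suffices h : ∀ k, ∀ i : Fin N, (i : ℕ) + 1 + k = N → T.shape.part i ≤ k by
    have := h (N - (i + 1)) i (by omega)
    omega
  intro k
  induction k with
  | zero => intro i hi; rw [T.shape.last i hi]
  | succ k ih =>
    intro i hi
    have := T.shape.step i ⟨i + 1, by omega⟩ rfl
    have := ih ⟨i + 1, by omega⟩ (by simp only; omega)
    omega

/-! ### Triangularity and the bases -/

section

open MvPolynomial

theorem sum_mul_comp_perm_le {N : ℕ} {f : Fin N → ℤ} (hf : StrictMono f)
    (τ : Equiv.Perm (Fin N)) : ∑ i : Fin N, ((i : ℕ) : ℤ) * f (τ i) ≤ ∑ i : Fin N, ((i : ℕ) : ℤ) * f i := by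
  have hm : Monovary (fun i : Fin N => ((i : ℕ) : ℤ)) f := fun i j hij =>
    Int.ofNat_le.2 (Fin.le_def.1 (hf.lt_iff_lt.1 hij).le)
  exact hm.sum_mul_comp_perm_le_sum_mul

theorem eq_one_of_sum_mul_comp_perm_eq {N : ℕ} {f : Fin N → ℤ} (hf : StrictMono f)
    {τ : Equiv.Perm (Fin N)}
    (h : ∑ i : Fin N, ((i : ℕ) : ℤ) * f (τ i) = ∑ i : Fin N, ((i : ℕ) : ℤ) * f i) : τ = 1 := by
  have hm : Monovary (fun i : Fin N => ((i : ℕ) : ℤ)) f := fun i j hij =>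
    Int.ofNat_le.2 (Fin.le_def.1 (hf.lt_iff_lt.1 hij).le)
  have h2 := hm.sum_mul_comp_perm_eq_sum_mul_iff.1 h
  have h3 : StrictMono (τ⁻¹ : Equiv.Perm (Fin N)) := by
    refine Monotone.strictMono_of_injective (fun i j hij => ?_) (τ⁻¹).injective
    rcases hij.eq_or_lt with rfl | hij
    · exact le_rfl
    · have := @h2 (τ⁻¹ i) (τ⁻¹ j) (by simpa using hf hij)
      simpa using this
  exact inv_eq_one.1 (perm_eq_one_of_strictMono h3)

/-- The statistic on words for which the transition matrix between monomials and reading forms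
is triangular. -/
def wordWeight {N : ℕ} (c : RibbonClass N) (w : Equiv.Perm (Fin N)) : ℤ :=
  ∑ i : Fin N, ((i : ℕ) : ℤ) * ((N : ℤ) * c.part i - (w i : ℕ))

/-- The hypothesis says that columns of the second tableau minus rows of the first form a
permutation. Multiplied by `N`, it splits `N * i` into rearrangements of the increasing sequences
`f` and `g`. Pairing with `i` and sorting both can only increase the sum, and equality forces both
rearrangements to be trivial. -/
theorem wordWeight_le_and_eq {N : ℕ} {c d : RibbonClass N} {v w π : Equiv.Perm (Fin N)}
    (hv : Compatible c v) (hw : Compatible d w)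
    (h : ∀ j, d.part (w.symm j) + (w.symm j : ℕ) = c.part (v.symm j) + (π j : ℕ)) :
    wordWeight c v ≤ wordWeight d w ∧ (wordWeight c v = wordWeight d w → v = w) := by
  let f : Fin N → ℤ := fun i => -((N : ℤ) * c.part i - (v i : ℕ))
  let g : Fin N → ℤ := fun i => (N : ℤ) * ((d.part i + i : ℕ) : ℤ) - (w i : ℕ)
  have hf : StrictMono f := fun i j hij => neg_lt_neg (hv.strictAnti hij)
  have hg : StrictMono g := hw.strictMono
  let ρ : Equiv.Perm (Fin N) := π.symm.trans v.symm
  let τ : Equiv.Perm (Fin N) := π.symm.trans w.symm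
  have key : ∀ i : Fin N, (N : ℤ) * (i : ℕ) = f (ρ i) + g (τ i) := by
    intro i
    have := h (π.symm i)
    rw [Equiv.apply_symm_apply] at this
    simp only [f, g, ρ, τ, Equiv.trans_apply, Equiv.apply_symm_apply, this]
    push_cast
    ring
  have hsum : ∑ i : Fin N, ((i : ℕ) : ℤ) * ((N : ℤ) * (i : ℕ)) =
      ∑ i : Fin N, ((i : ℕ) : ℤ) * f (ρ i) + ∑ i : Fin N, ((i : ℕ) : ℤ) * g (τ i) := by
    rw [← Finset.sum_add_distrib]
    exact Finset.sum_congr rfl fun i _ => by rw [key, mul_add]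
  have hcv : ∑ i : Fin N, ((i : ℕ) : ℤ) * f i = -wordWeight c v := by
    rw [wordWeight, ← Finset.sum_neg_distrib]
    exact Finset.sum_congr rfl fun i _ => by simp only [f]; ring
  have hdw : ∑ i : Fin N, ((i : ℕ) : ℤ) * g i = wordWeight d w +
      ∑ i : Fin N, ((i : ℕ) : ℤ) * ((N : ℤ) * (i : ℕ)) := by
    rw [wordWeight, ← Finset.sum_add_distrib]
    exact Finset.sum_congr rfl fun i _ => by simp only [g]; push_cast; ring
  have h1 := sum_mul_comp_perm_le hf ρ
  have h2 := sum_mul_comp_perm_le hg τ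
  refine ⟨by linarith, fun he => ?_⟩
  have hρ : ρ = 1 := eq_one_of_sum_mul_comp_perm_eq hf (by linarith)
  have hτ : τ = 1 := eq_one_of_sum_mul_comp_perm_eq hg (by linarith)
  ext i
  have h3 := DFunLike.congr_fun (hρ.trans hτ.symm) (π (v i))
  simp only [ρ, τ, Equiv.trans_apply, Equiv.symm_apply_apply] at h3
  rw [Equiv.eq_symm_apply] at h3
  rw [h3]

/-- A family is linearly independent if a family of functionals is triangular on it. -/
theorem linearIndependent_of_triangular {K V ι : Type*} [Field K] [AddCommGroup V] [Module K V]
    (F : ι → V) (φ : ι → V →ₗ[K] K) (m : ι → ℤ) (hdiag : ∀ i, φ i (F i) ≠ 0)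
    (htri : ∀ i j, i ≠ j → φ i (F j) ≠ 0 → m i < m j) : LinearIndependent K F := by
  classical
  rw [linearIndependent_iff']
  intro s a hs
  by_contra! hne
  obtain ⟨i0, hi0, ha0⟩ := hne
  -- At an index of maximal `m` with nonzero coefficient, `φ i` kills all other terms of the
  -- relation.
  obtain ⟨i, hi, hmax⟩ := (s.filter fun i => a i ≠ 0).exists_max_image m
    ⟨i0, Finset.mem_filter.2 ⟨hi0, ha0⟩⟩
  rw [Finset.mem_filter] at hi
  have h := congrArg (φ i) hs
  rw [map_sum, map_zero, Finset.sum_eq_single_of_mem i hi.1] at h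
  · rw [map_smul, smul_eq_mul] at h
    exact (mul_eq_zero.1 h).elim hi.2 (hdiag i)
  · intro j hj hji
    rw [map_smul, smul_eq_mul]
    by_contra hne
    have h1 := mul_ne_zero_iff.1 hne
    have h2 := hmax j (Finset.mem_filter.2 ⟨hj, h1.1⟩)
    exact absurd (htri i j hji.symm h1.2) (not_lt.2 h2)

theorem RibbonTableau.column_eq {N : ℕ} (T : RibbonTableau N) (e : Fin N) :
    T.column e = T.shape.part (T.word.symm e) + (T.word.symm e : ℕ) := by
  rw [← T.column_word, Equiv.apply_symm_apply]

/-- The functional of `T` is the coefficient of the monomial of row coordinates. On the diagonal it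
is nonzero because column minus row is the position in the ribbon. -/
theorem linearIndependent_readingForm (K : Type*) [Field K] [CharZero K] {N : ℕ}
    (σ : Equiv.Perm (Fin N)) :
    LinearIndependent K fun T : RibbonTableau N => readingForm K σ T := by
  refine linearIndependent_of_triangular _
    (fun T => lcoeff K (Finsupp.equivFunOnFinite.symm fun j =>
      T.shape.part (T.word.symm (σ j))))
    (fun T => wordWeight T.shape T.word) (fun T => ?_) (fun T T' hne h => ?_)
  · rw [lcoeff_apply, readingForm, coeff_cvForm_ne_zero_iff]
    exact ⟨σ.trans T.word.symm, fun j => T.column_eq _⟩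
  · rw [lcoeff_apply, readingForm, coeff_cvForm_ne_zero_iff] at h
    obtain ⟨π, hπ⟩ := h
    have h2 := wordWeight_le_and_eq (π := σ.symm.trans π) T.compatible_word T'.compatible_word
      fun j => by
        have := hπ (σ.symm j)
        simpa [T'.column_eq] using this
    exact lt_of_le_of_ne h2.1 fun he => hne (RibbonTableau.word_injective (h2.2 he))

theorem isHomogeneous_readingForm (K : Type*) [Field K] {N : ℕ} (σ : Equiv.Perm (Fin N))
    (T : RibbonTableau N) : (readingForm K σ T).IsHomogeneous T.shape.size := by
  refine cvForm_isHomogeneous K ?_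
  rw [Equiv.sum_comp σ T.column, ← Equiv.sum_comp T.word, RibbonClass.size,
    ← Finset.sum_add_distrib]
  exact Finset.sum_congr rfl fun i _ => T.column_word i

theorem readingForm_mem_cvSpan (K : Type*) [Field K] {N : ℕ} (σ : Equiv.Perm (Fin N))
    (T : RibbonTableau N) : readingForm K σ T ∈ cvSpan K N :=
  Submodule.subset_span ⟨fun i => ⟨T.column (σ i), T.column_lt _⟩, rfl⟩

theorem harmonics_le_span_readingForm (K : Type*) [Field K] [CharZero K] {N : ℕ}
    (σ : Equiv.Perm (Fin N)) :
    harmonics K N ≤ Submodule.span K (Set.range fun T : RibbonTableau N => readingForm K σ T) := by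
  obtain ⟨hfin, hle⟩ := finite_and_finrank_harmonics_le K N
  have hsub : Submodule.span K (Set.range fun T : RibbonTableau N => readingForm K σ T) ≤
      harmonics K N := by
    rw [Submodule.span_le]
    rintro _ ⟨T, rfl⟩
    exact cvSpan_le_harmonics K N (readingForm_mem_cvSpan K σ T)
  have := Fintype.ofFinite (RibbonTableau N)
  refine (Submodule.eq_of_le_of_finrank_le hsub ?_).ge
  rw [finrank_span_eq_card (linearIndependent_readingForm K σ), ← Nat.card_eq_fintype_card,
    card_ribbonTableau]
  exact hle

theorem cvSpan_eq_harmonics (K : Type*) [Field K] [CharZero K] (N : ℕ) :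
    cvSpan K N = harmonics K N := by
  refine (cvSpan_le_harmonics K N).antisymm ((harmonics_le_span_readingForm K 1).trans ?_)
  rw [Submodule.span_le]
  rintro _ ⟨T, rfl⟩
  exact readingForm_mem_cvSpan K 1 T

theorem span_readingForm (K : Type*) [Field K] [CharZero K] {N : ℕ} (σ : Equiv.Perm (Fin N)) :
    Submodule.span K (Set.range fun T : RibbonTableau N => readingForm K σ T) = cvSpan K N := by
  refine le_antisymm ?_ ((cvSpan_le_harmonics K N).trans (harmonics_le_span_readingForm K σ))
  rw [Submodule.span_le]
  rintro _ ⟨T, rfl⟩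
  exact readingForm_mem_cvSpan K σ T

end

/-! ### Different reading orders give different bases -/

section

open MvPolynomial

/-- The monomial with exponents `b` occurs in the form that encodes `T` when the entries are
read in their natural order. -/
def Occurs {N : ℕ} (T : RibbonTableau N) (b : Fin N → ℕ) : Prop :=
  ∃ π : Equiv.Perm (Fin N), ∀ e, T.column e = b e + (π e : ℕ)

theorem coeff_readingForm_ne_zero_iff (K : Type*) [Field K] [CharZero K] {N : ℕ}
    (σ : Equiv.Perm (Fin N)) (T : RibbonTableau N) (b : Fin N → ℕ) :
    coeff (Finsupp.equivFunOnFinite.symm fun j => b (σ j)) (readingForm K σ T) ≠ 0 ↔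
      Occurs T b := by
  rw [readingForm, coeff_cvForm_ne_zero_iff]
  constructor
  · rintro ⟨π, hπ⟩
    exact ⟨σ.symm.trans π, fun e => by simpa using hπ (σ.symm e)⟩
  · rintro ⟨π, hπ⟩
    exact ⟨σ.trans π, fun j => hπ (σ j)⟩

/-- A common form determines degree and support; passing between exponents indexed by entries for
the two readings costs the relabelling `e ↦ σ (τ⁻¹ e)`. -/
theorem exists_size_eq_and_occurs_iff (K : Type*) [Field K] [CharZero K] {N : ℕ}
    {σ τ : Equiv.Perm (Fin N)} {T : RibbonTableau N}
    (h : readingForm K σ T ∈ Set.range fun T' : RibbonTableau N => readingForm K τ T') :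
    ∃ T' : RibbonTableau N, T'.shape.size = T.shape.size ∧
      readingForm K τ T' = readingForm K σ T ∧
      ∀ b, Occurs T b ↔ Occurs T' (b ∘ τ.symm.trans σ) := by
  obtain ⟨T', hT'⟩ := h
  refine ⟨T', ?_, hT', fun b => ?_⟩
  · have h1 := isHomogeneous_readingForm K τ T'
    rw [show readingForm K τ T' = readingForm K σ T from hT'] at h1
    exact h1.inj_right (isHomogeneous_readingForm K σ T)
      ((linearIndependent_readingForm K σ).ne_zero T)
  · rw [← coeff_readingForm_ne_zero_iff K σ, ← coeff_readingForm_ne_zero_iff K τ, ← hT']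
    simp

/-- The ribbon class `(1, …, 1, 0, …, 0)` with `k` entries `1`. -/
def hookClass {N : ℕ} (k : ℕ) (hk : k + 1 ≤ N ∨ k = 0) : RibbonClass N where
  part i := if (i : ℕ) < k then 1 else 0
  antitone i j h := by
    rw [Fin.le_def] at h
    dsimp only
    split_ifs <;> omega
  step i j h := by
    split_ifs <;> omega
  last i h := by
    split_ifs <;> omega

theorem hookClass_part {N : ℕ} (k : ℕ) (hk : k + 1 ≤ N ∨ k = 0) (i : Fin N) :
    (hookClass k hk).part i = if (i : ℕ) < k then 1 else 0 := rfl

theorem hookClass_size {N : ℕ} (k : ℕ) (hk : k + 1 ≤ N ∨ k = 0) :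
    (hookClass k hk : RibbonClass N).size = k := by
  simp only [RibbonClass.size, hookClass_part]
  rw [Finset.sum_boole, Nat.cast_id, Fin.card_filter_val_lt]
  omega

theorem compatible_hookClass {N : ℕ} {k : ℕ} (hk : k + 1 ≤ N ∨ k = 0) {w : Equiv.Perm (Fin N)}
    (h1 : ∀ i j : Fin N, (i : ℕ) + 1 = j → (j : ℕ) ≠ k → w i < w j)
    (h2 : ∀ i j : Fin N, (i : ℕ) + 1 = j → (j : ℕ) = k → w j < w i) :
    Compatible (hookClass k hk) w := by
  intro i j hij
  rw [hookClass_part, hookClass_part]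
  constructor
  · intro h
    refine h1 i j hij ?_
    split_ifs at h <;> omega
  · intro h
    refine h2 i j hij ?_
    split_ifs at h <;> omega

theorem exists_size_zero (N : ℕ) : ∃ T : RibbonTableau N, T.shape.size = 0 := by
  have h : Compatible (hookClass 0 (Or.inr rfl) : RibbonClass N) 1 :=
    compatible_hookClass _ (fun i j hij _ => by rw [Fin.lt_def]; exact hij ▸ Nat.lt_succ_self _)
      (fun i j hij h => by omega)
  exact ⟨h.tableau, hookClass_size 0 (Or.inr rfl)⟩

theorem column_of_size_zero {N : ℕ} {T : RibbonTableau N} (h : T.shape.size = 0) (e : Fin N) :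
    T.column e = e := by
  have hp : ∀ i, T.shape.part i = 0 := fun i => Finset.sum_eq_zero_iff.1 h i (Finset.mem_univ i)
  have hw : T.word = 1 := by
    refine perm_eq_one_of_strictMono (strictMono_of_lt_next fun i j hij => ?_)
    exact (T.compatible_word i j hij).1 (by rw [hp, hp])
  rw [T.column_eq, hp, hw, zero_add]
  rfl

theorem coeff_zero_readingForm (K : Type*) [Field K] {N : ℕ} (σ : Equiv.Perm (Fin N))
    {T : RibbonTableau N} (h : T.shape.size = 0) :
    coeff 0 (readingForm K σ T) = ((Equiv.Perm.sign σ : ℤ) : K) := by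
  rw [readingForm, coeff_cvForm_of_eq_add (π := σ) K fun j => by simp [column_of_size_zero h]]
  simp

theorem sign_eq_of_range_eq (K : Type*) [Field K] [CharZero K] {N : ℕ}
    {σ τ : Equiv.Perm (Fin N)}
    (h : ∀ T, readingForm K σ T ∈ Set.range fun T' : RibbonTableau N => readingForm K τ T') :
    Equiv.Perm.sign σ = Equiv.Perm.sign τ := by
  obtain ⟨T, hT⟩ := exists_size_zero N
  obtain ⟨T', hs, hf, -⟩ := exists_size_eq_and_occurs_iff K (h T)
  have h1 := coeff_zero_readingForm K τ (hs.trans hT)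
  rw [hf, coeff_zero_readingForm K σ hT] at h1
  exact Units.ext (by exact_mod_cast h1)

/-- The word is `a, 0` followed by the other entries in increasing order; its only descent is the
first step. -/
theorem exists_size_one {m : ℕ} {a : Fin (m + 3)} (ha : a ≠ 0) :
    ∃ T : RibbonTableau (m + 3), T.shape.size = 1 ∧ T.word 0 = a ∧ T.word 1 = 0 := by
  have h0 : a.cycleRange.symm 0 = a := Fin.cycleRange_symm_zero a
  have hs : ∀ j : Fin (m + 2), a.cycleRange.symm j.succ = a.succAbove j :=
    fun j => Fin.cycleRange_symm_succ a j
  have h1 : a.cycleRange.symm 1 = 0 := by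
    rw [← Fin.succ_zero_eq_one, hs, Fin.succAbove_ne_zero_zero ha]
  have h : Compatible (hookClass 1 (Or.inl (by omega)) : RibbonClass (m + 3))
      a.cycleRange.symm := by
    refine compatible_hookClass _ (fun i j hij hj => ?_) (fun i j hij hj => ?_)
    · induction i using Fin.cases with
      | zero => simp at hij; omega
      | succ i =>
        induction j using Fin.cases with
        | zero => simp at hij
        | succ j =>
          rw [hs, hs]
          refine Fin.strictMono_succAbove a ?_
          simp only [Fin.val_succ] at hij
          rw [Fin.lt_def]
          omega
    · obtain rfl : i = 0 := Fin.ext (by rw [Fin.val_zero]; omega)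
      obtain rfl : j = 1 := Fin.ext (by simpa using hj)
      rw [h0, h1]
      exact Fin.pos_iff_ne_zero.2 ha
  refine ⟨h.tableau, ?_, by rw [h.word_tableau, h0], by rw [h.word_tableau, h1]⟩
  exact hookClass_size 1 (Or.inl (by omega))

/-- The word is `a, b, 0` followed by the other entries in increasing order, with the only descent
after `b`. It is composed of two inverse cycles, which insert `b` and `a` in front. -/
theorem exists_size_two {m : ℕ} {a b : Fin (m + 3)} (ha : a ≠ 0) (hab : a < b) :
    ∃ T : RibbonTableau (m + 3), T.shape.size = 2 ∧ T.word 0 = a ∧ T.word 1 = b ∧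
      T.word 2 = 0 := by
  have hb : b ≠ 0 := fun h => by simp [h] at hab
  obtain ⟨a, rfl⟩ : ∃ a' : Fin (m + 2), a = a'.castSucc :=
    ⟨a.castPred (Fin.ne_last_of_lt hab), by simp⟩
  have ha' : a ≠ 0 := fun h => ha (by simp [h])
  let w : Equiv.Perm (Fin (m + 3)) := a.succ.cycleRange.symm.trans b.cycleRange.symm
  have h0 : w 0 = a.castSucc := by
    simp only [w, Equiv.trans_apply]
    rw [Fin.cycleRange_symm_zero, Fin.cycleRange_symm_succ, Fin.succAbove_of_castSucc_lt _ _ hab]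
  have h1 : w 1 = b := by
    simp only [w, Equiv.trans_apply]
    rw [← Fin.succ_zero_eq_one, Fin.cycleRange_symm_succ,
      Fin.succAbove_ne_zero_zero (Fin.succ_ne_zero a), Fin.cycleRange_symm_zero]
  have hs : ∀ j : Fin (m + 1), w j.succ.succ = b.succAbove (a.succAbove j) := by
    intro j
    simp only [w, Equiv.trans_apply]
    rw [Fin.cycleRange_symm_succ, Fin.succ_succAbove_succ, Fin.cycleRange_symm_succ]
  have h2 : w 2 = 0 := by
    have := hs 0
    rw [Fin.succAbove_ne_zero_zero ha', Fin.succAbove_ne_zero_zero hb] at this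
    exact this
  have h : Compatible (hookClass 2 (Or.inl (by omega)) : RibbonClass (m + 3)) w := by
    refine compatible_hookClass _ (fun i j hij hj => ?_) (fun i j hij hj => ?_)
    · induction i using Fin.cases with
      | zero =>
        obtain rfl : j = 1 := Fin.ext (by simpa using hij.symm)
        rwa [h0, h1]
      | succ i =>
        induction i using Fin.cases with
        | zero => simp at hij; omega
        | succ i =>
          induction j using Fin.cases with
          | zero => simp at hij
          | succ j =>
            induction j using Fin.cases with
            | zero => simp at hij
            | succ j =>
              rw [hs, hs]
              refine Fin.strictMono_succAbove b (Fin.strictMono_succAbove a ?_)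
              simp only [Fin.val_succ] at hij
              rw [Fin.lt_def]
              omega
    · obtain rfl : i = 1 := Fin.ext (by rw [Fin.val_one]; omega)
      obtain rfl : j = 2 := Fin.ext (by rw [Fin.val_two, hj])
      rw [h1, h2]
      exact Fin.pos_iff_ne_zero.2 hb
  refine ⟨h.tableau, ?_, by rw [h.word_tableau, h0], by rw [h.word_tableau, h1],
    by rw [h.word_tableau, h2]⟩
  exact hookClass_size 2 (Or.inl (by omega))

theorem part_of_size_one {m : ℕ} {c : RibbonClass (m + 3)} (h : c.size = 1) (i : Fin (m + 3)) :
    c.part i = if (i : ℕ) < 1 then 1 else 0 := by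
  have h0 : c.part 1 ≤ c.part 0 := c.antitone (Fin.zero_le _)
  rw [RibbonClass.size, Fin.sum_univ_succ, Fin.sum_univ_succ, Fin.succ_zero_eq_one] at h
  have hi : ∀ i : Fin (m + 2), c.part i.succ = 0 := by
    intro i
    have : c.part i.succ ≤ c.part 1 := c.antitone (by simp [Fin.le_def])
    omega
  have h1 : c.part 1 = 0 := hi 0
  simp only [hi, Finset.sum_const_zero] at h
  induction i using Fin.cases with
  | zero => simp; omega
  | succ i => simp [hi]

theorem part_of_size_two {m : ℕ} {c : RibbonClass (m + 3)} (h : c.size = 2) (i : Fin (m + 3)) :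
    c.part i = if (i : ℕ) < 2 then 1 else 0 := by
  have h0 : c.part 1 ≤ c.part 0 := c.antitone (Fin.zero_le _)
  have h1 : c.part 2 ≤ c.part 1 := c.antitone (by simp [Fin.le_def, Fin.val_two, -Fin.coe_ofNat_eq_mod])
  have h2 := c.step 0 1 (by simp)
  have h3 := c.step 1 2 rfl
  rw [RibbonClass.size, Fin.sum_univ_succ, Fin.sum_univ_succ, Fin.sum_univ_succ] at h
  have e1 : (Fin.succ 0 : Fin (m + 3)) = 1 := rfl
  have e2 : (Fin.succ (Fin.succ 0) : Fin (m + 3)) = 2 := rfl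
  rw [e1, e2] at h
  have hi : ∀ i : Fin (m + 1), c.part i.succ.succ = 0 := by
    intro i
    have : c.part i.succ.succ ≤ c.part 2 := c.antitone (by
      rw [Fin.le_def, Fin.val_two, Fin.val_succ, Fin.val_succ]; omega)
    omega
  have h4 : c.part 2 = 0 := hi 0
  simp only [hi, Finset.sum_const_zero] at h
  induction i using Fin.cases with
  | zero => simp; omega
  | succ i =>
    induction i using Fin.cases with
    | zero => simp; omega
    | succ i => simp [hi]

theorem occurs_of_word {N : ℕ} {T : RibbonTableau N} {b : Fin N → ℕ} (s : Equiv.Perm (Fin N))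
    (h : ∀ i, T.shape.part i + (i : ℕ) = b (T.word i) + (s i : ℕ)) : Occurs T b := by
  refine ⟨T.word.symm.trans s, fun e => ?_⟩
  have := h (T.word.symm e)
  rw [Equiv.apply_symm_apply] at this
  rw [T.column_eq, this]
  rfl

/-- No box lies in column 0, so the entry to which `π` assigns 0 must be the one with positive
exponent. -/
theorem column_eq_one_of_occurs_single {m : ℕ} {T : RibbonTableau (m + 3)}
    (h : T.shape.size = 1) {x : Fin (m + 3)} (hx : Occurs T (Pi.single x 1)) :
    T.column x = 1 := by
  obtain ⟨π, hπ⟩ := hx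
  have h1 := hπ (π.symm 0)
  have hpos : T.column (π.symm 0) ≠ 0 := by
    rw [T.column_eq, part_of_size_one h]
    split_ifs <;> omega
  rw [Equiv.apply_symm_apply] at h1
  by_cases hx : π.symm 0 = x
  · rw [hx] at h1
    simpa using h1
  · rw [Pi.single_eq_of_ne hx] at h1
    exact absurd h1 hpos

/-- The word increases from its second letter on, so the least entry is at position 0 or 1. Both
boxes lie in column 1, and a transposition exchanges their roles. -/
theorem occurs_single_zero {m : ℕ} {T : RibbonTableau (m + 3)} (h : T.shape.size = 1) :
    Occurs T (Pi.single 0 1) := by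
  have hp := part_of_size_one h
  obtain ⟨i, hi⟩ := T.word.surjective 0
  have hi1 : (i : ℕ) ≤ 1 := by
    by_contra hlt
    have h1 := T.compatible_word.strictAnti (show (1 : Fin (m + 3)) < i by
      rw [Fin.lt_def]; simp; omega)
    simp only [hp, hi] at h1
    rw [if_neg (by omega), if_neg (by simp)] at h1
    simp at h1
    omega
  rw [← hi]
  rcases Nat.le_one_iff_eq_zero_or_eq_one.1 hi1 with h0 | h0
  · obtain rfl : i = 0 := Fin.ext h0
    refine occurs_of_word 1 fun j => ?_
    rw [hp, Equiv.Perm.one_apply]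
    by_cases hj : j = 0
    · simp [hj]
    · rw [Pi.single_eq_of_ne fun he => hj (T.word.injective he), if_neg]
      have : (j : ℕ) ≠ 0 := fun h => hj (Fin.ext h)
      omega
  · obtain rfl : i = 1 := Fin.ext h0
    refine occurs_of_word (Equiv.swap 0 1) fun j => ?_
    rw [hp]
    by_cases hj : j = 1
    · simp [hj]
    · rw [Pi.single_eq_of_ne fun he => hj (T.word.injective he)]
      by_cases hj0 : j = 0
      · simp [hj0]
      · rw [Equiv.swap_apply_of_ne_of_ne hj0 hj, if_neg]
        have : (j : ℕ) ≠ 0 := fun h => hj0 (Fin.ext h)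
        omega

theorem RibbonTableau.column_eq_one_iff_of_size_two {m : ℕ} {T : RibbonTableau (m + 3)}
    (h : T.shape.size = 2) {x : Fin (m + 3)} : T.column x = 1 ↔ x = T.word 0 := by
  rw [T.column_eq, part_of_size_two h, ← Equiv.symm_apply_eq]
  constructor
  · intro h
    apply Fin.ext
    rw [Fin.val_zero]
    split_ifs at h <;> omega
  · intro h
    simp [h]

/-- Column 0 is empty and column 1 has a single box. Hence the entries to which `π` assigns 0 and 1
both need exponent 1, and they lie in columns 1 and 2. -/
theorem column_of_occurs_single_add_single {m : ℕ} {T : RibbonTableau (m + 3)}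
    (h : T.shape.size = 2) {x y : Fin (m + 3)}
    (hxy : Occurs T (Pi.single x 1 + Pi.single y 1)) (hne : x ≠ y) :
    T.column x = 1 ∧ T.column y = 2 ∨ T.column x = 2 ∧ T.column y = 1 := by
  obtain ⟨π, hπ⟩ := hxy
  have hpos : ∀ e, T.column e ≠ 0 := by
    intro e
    rw [T.column_eq, part_of_size_two h]
    split_ifs <;> omega
  have h0 := hπ (π.symm 0)
  have h1 := hπ (π.symm 1)
  have hp0 := hpos (π.symm 0)
  have hp1 := hpos (π.symm 1)
  have hne' : π.symm 1 ≠ π.symm 0 := fun he => by simpa using π.symm.injective he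
  have huniq : ¬ (T.column (π.symm 0) = 1 ∧ T.column (π.symm 1) = 1) := fun he => hne' (by
    rw [(RibbonTableau.column_eq_one_iff_of_size_two h).1 he.1,
      (RibbonTableau.column_eq_one_iff_of_size_two h).1 he.2])
  rw [Equiv.apply_symm_apply] at h0 h1
  generalize π.symm 0 = p at *
  generalize π.symm 1 = q at *
  simp only [Pi.add_apply, Pi.single_apply, Fin.val_zero, Fin.val_one] at h0 h1
  by_cases hpx : p = x <;> by_cases hpy : p = y <;> by_cases hqx : q = x <;>
    by_cases hqy : q = y <;> simp_all

theorem occurs_single_add_single {m : ℕ} {T : RibbonTableau (m + 3)} (h : T.shape.size = 2) :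
    Occurs T (Pi.single (T.word 0) 1 + Pi.single (T.word 1) 1) ∧
      Occurs T (Pi.single (T.word 0) 1 + Pi.single (T.word 2) 1) := by
  have hp := part_of_size_two h
  have h01 : (1 : Fin (m + 3)) ≠ 0 := by simp
  have h02 : (2 : Fin (m + 3)) ≠ 0 := Fin.ne_of_val_ne two_ne_zero
  have h12 : (2 : Fin (m + 3)) ≠ 1 := Fin.ne_of_val_ne (Nat.succ_ne_self 1)
  constructor
  · refine occurs_of_word 1 fun j => ?_
    rw [hp]
    simp only [Pi.add_apply, Pi.single_apply, T.word.injective.eq_iff, Equiv.Perm.one_apply]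
    by_cases h0 : j = 0
    · simp [h0]
    by_cases h1 : j = 1
    · simp [h1]
    have h0' : (j : ℕ) ≠ 0 := fun h => h0 (Fin.ext h)
    have h1' : (j : ℕ) ≠ 1 := fun h => h1 (Fin.ext h)
    rw [if_neg h0, if_neg h1, if_neg (by omega), add_zero]
  · refine occurs_of_word (Equiv.swap 1 2) fun j => ?_
    rw [hp]
    simp only [Pi.add_apply, Pi.single_apply, T.word.injective.eq_iff]
    by_cases h0 : j = 0
    · subst h0
      rw [Equiv.swap_apply_of_ne_of_ne h01.symm h02.symm]
      simp [h02.symm]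
    by_cases h1 : j = 1
    · subst h1
      simp [h12.symm, Fin.val_two, -Fin.coe_ofNat_eq_mod]
    by_cases h2 : j = 2
    · subst h2
      simp [h02, Fin.val_two, -Fin.coe_ofNat_eq_mod]
    have h0' : (j : ℕ) ≠ 0 := fun h => h0 (Fin.ext h)
    have h1' : (j : ℕ) ≠ 1 := fun h => h1 (Fin.ext h)
    rw [if_neg h0, if_neg h2, if_neg (by omega),
      Equiv.swap_apply_of_ne_of_ne h1 h2, add_zero]

/-- The common entry `x` must occupy the only box of column 1, so it is the first letter. Then `y`
and `0` fill column 2, with `0` on top, so `y` is the second letter, and the first step is an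
ascent. -/
theorem lt_of_occurs_single_add_single {m : ℕ} {T : RibbonTableau (m + 3)}
    (h : T.shape.size = 2) {x y : Fin (m + 3)} (hx : x ≠ 0) (hy : y ≠ 0) (hxy : x ≠ y)
    (h1 : Occurs T (Pi.single x 1 + Pi.single y 1))
    (h2 : Occurs T (Pi.single x 1 + Pi.single 0 1)) : x < y := by
  have hp := part_of_size_two h
  have hcol := @RibbonTableau.column_eq_one_iff_of_size_two m T h
  have c1 := column_of_occurs_single_add_single h h1 hxy
  have c2 := column_of_occurs_single_add_single h h2 hx
  have hx1 : T.column x = 1 := by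
    rcases c1 with c1 | c1
    · exact c1.1
    · rcases c2 with c2 | c2
      · exact c2.1
      · exact absurd ((hcol.1 c1.2).trans (hcol.1 c2.2).symm) hy
  have hy2 : T.column y = 2 := by omega
  have h02 : T.column 0 = 2 := by omega
  have hx0 := hcol.1 hx1
  have hcol2 : ∀ e, T.column e = 2 → e = T.word 1 ∨ e = T.word 2 := by
    intro e he
    rw [T.column_eq, hp] at he
    rw [← Equiv.symm_apply_eq, ← Equiv.symm_apply_eq]
    by_cases h3 : ((T.word.symm e : Fin (m + 3)) : ℕ) < 2
    · left
      apply Fin.ext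
      rw [if_pos h3] at he
      rw [Fin.val_one]
      omega
    · right
      apply Fin.ext
      rw [if_neg h3] at he
      rw [Fin.val_two]
      omega
  have h12 : T.word 2 < T.word 1 := (T.compatible_word 1 2 rfl).2 (by rw [hp, hp]; rfl)
  have h01 : T.word 0 < T.word 1 := (T.compatible_word 0 1 (by simp)).1 (by simp [hp])
  have hz : T.word 1 ≠ 0 := fun hz => by simp [hz] at h12
  have hy1 : y = T.word 1 := by
    rcases hcol2 y hy2 with h3 | h3
    · exact h3
    · rcases hcol2 0 h02 with h4 | h4
      · exact absurd h4.symm hz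
      · exact absurd (h3.trans h4.symm) hy
  rw [hx0, hy1]
  exact h01

theorem single_comp_perm {N : ℕ} (x : Fin N) (κ : Equiv.Perm (Fin N)) :
    (Pi.single x 1 : Fin N → ℕ) ∘ κ = Pi.single (κ.symm x) 1 := by
  funext e
  simp [Pi.single_apply, Equiv.eq_symm_apply]

theorem eq_one_of_occurs_iff {m : ℕ} {κ : Equiv.Perm (Fin (m + 3))}
    (h : ∀ T : RibbonTableau (m + 3), ∃ T' : RibbonTableau (m + 3),
      T'.shape.size = T.shape.size ∧ ∀ b, Occurs T b ↔ Occurs T' (b ∘ κ)) : κ = 1 := by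
  have hκ : κ 0 = 0 := by
    by_contra hne
    -- A third entry exists since there are at least three. In the word `a, 0, …` only `a` and `0`
    -- lie in column 1, whereas the support condition would put `κ 0` there.
    obtain ⟨a, ha, haκ⟩ : ∃ a : Fin (m + 3), a ≠ 0 ∧ a ≠ κ 0 := by
      by_cases h1 : κ 0 = 1
      · exact ⟨2, Fin.ne_of_val_ne two_ne_zero, by
          rw [h1]; exact Fin.ne_of_val_ne (Nat.succ_ne_self 1)⟩
      · exact ⟨1, by simp, fun h2 => h1 h2.symm⟩
    obtain ⟨T, hT, h0, h1⟩ := exists_size_one ha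
    obtain ⟨T', hT', hb⟩ := h T
    have h2 : Occurs T (Pi.single (κ 0) 1) := by
      rw [hb, single_comp_perm, Equiv.symm_apply_apply]
      exact occurs_single_zero (hT'.trans hT)
    have h3 := column_eq_one_of_occurs_single hT h2
    rw [T.column_eq, part_of_size_one hT] at h3
    have h4 : T.word.symm (κ 0) = 0 ∨ T.word.symm (κ 0) = 1 := by
      rw [Fin.ext_iff, Fin.ext_iff, Fin.val_zero, Fin.val_one]
      split_ifs at h3 <;> omega
    rw [Equiv.symm_apply_eq, Equiv.symm_apply_eq, h0, h1] at h4
    exact h4.elim (fun h => haκ h.symm) hne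
  have hκ' : κ.symm 0 = 0 := by rw [Equiv.symm_apply_eq, hκ]
  have hmono : StrictMono (κ⁻¹ : Equiv.Perm (Fin (m + 3))) := by
    intro a b hab
    change κ.symm a < κ.symm b
    have hb0 : κ.symm b ≠ 0 := fun hb => by
      rw [Equiv.symm_apply_eq, hκ] at hb
      simp [hb] at hab
    by_cases ha : a = 0
    · rw [ha, hκ']
      exact Fin.pos_iff_ne_zero.2 hb0
    · obtain ⟨T, hT, h0, h1, h2⟩ := exists_size_two ha hab
      obtain ⟨T', hT', hb⟩ := h T
      have h3 := occurs_single_add_single hT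
      rw [h0, h1, h2, hb, hb] at h3
      have hadd : ∀ x y : Fin (m + 3), ((Pi.single x 1 + Pi.single y 1 : Fin (m + 3) → ℕ) ∘ κ) =
          Pi.single (κ.symm x) 1 + Pi.single (κ.symm y) 1 := fun x y => by
        rw [← single_comp_perm, ← single_comp_perm]
        rfl
      rw [hadd, hadd, hκ'] at h3
      refine lt_of_occurs_single_add_single (hT'.trans hT) (fun hz => ha ?_) hb0
        (fun he => hab.ne (κ.symm.injective he)) h3.1 h3.2
      rw [Equiv.symm_apply_eq, hκ] at hz
      exact hz
  exact inv_eq_one.1 (perm_eq_one_of_strictMono hmono)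

theorem perm_eq_of_range_eq (K : Type*) [Field K] [CharZero K] {N : ℕ}
    {σ τ : Equiv.Perm (Fin N)}
    (h : ∀ T, readingForm K σ T ∈ Set.range fun T' : RibbonTableau N => readingForm K τ T') :
    σ = τ := by
  have hsign := sign_eq_of_range_eq K h
  match N, σ, τ, h, hsign with
  | 0, σ, τ, _, _ => exact Subsingleton.elim _ _
  | 1, σ, τ, _, _ => exact Subsingleton.elim _ _
  -- With two variables the supports are symmetric under the transposition, so only the sign
  -- separates the two orders.
  | 2, σ, τ, _, hsign =>
    exact (by decide : ∀ σ τ : Equiv.Perm (Fin 2),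
      Equiv.Perm.sign σ = Equiv.Perm.sign τ → σ = τ) σ τ hsign
  | m + 3, σ, τ, h, _ =>
    have h1 : τ.symm.trans σ = 1 := eq_one_of_occurs_iff fun T =>
      let ⟨T', h1, _, h2⟩ := exists_size_eq_and_occurs_iff K (h T)
      ⟨T', h1, h2⟩
    ext i
    have := DFunLike.congr_fun h1 (τ i)
    rw [Equiv.trans_apply, Equiv.symm_apply_apply, Equiv.Perm.one_apply] at this
    rw [this]

end

end ConfluentVandermonde

theorem mainTheorem2 (K : Type*) [Field K] [CharZero K] (N : ℕ) :
    Nat.card (ConfluentVandermonde.RibbonTableau N) = N.factorial ∧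
    ConfluentVandermonde.cvSpan K N = ConfluentVandermonde.harmonics K N ∧
    (∀ σ : Equiv.Perm (Fin N),
      LinearIndependent K (fun T : ConfluentVandermonde.RibbonTableau N =>
        ConfluentVandermonde.readingForm K σ T) ∧
      Submodule.span K (Set.range fun T : ConfluentVandermonde.RibbonTableau N =>
        ConfluentVandermonde.readingForm K σ T) = ConfluentVandermonde.cvSpan K N ∧
      ∀ T : ConfluentVandermonde.RibbonTableau N,
        (ConfluentVandermonde.readingForm K σ T).IsHomogeneous T.shape.size) ∧
    Function.Injective (fun σ : Equiv.Perm (Fin N) =>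
      Set.range fun T : ConfluentVandermonde.RibbonTableau N =>
        ConfluentVandermonde.readingForm K σ T) := by
  refine ⟨ConfluentVandermonde.card_ribbonTableau N,
    ConfluentVandermonde.cvSpan_eq_harmonics K N,
    fun σ => ⟨ConfluentVandermonde.linearIndependent_readingForm K σ,
      ConfluentVandermonde.span_readingForm K σ,
      ConfluentVandermonde.isHomogeneous_readingForm K σ⟩, fun σ τ h => ?_⟩
  refine ConfluentVandermonde.perm_eq_of_range_eq K fun T => ?_
  rw [← show (Set.range fun T => ConfluentVandermonde.readingForm K σ T) =
    Set.range fun T => ConfluentVandermonde.readingForm K τ T from h]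
  exact ⟨T, rfl⟩
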